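/- Let $d,m$ be integers with $d,m\ge 1$, $\theta\in(0,\pi/2)$, and $\alpha\in\mathbb{N}^d$ a multi-index. Put $C(\theta)=\dfrac{16(1+\sin\theta)^2m^2}{3\sin^2\theta}$. For a nonempty finite $X\subset\Omega\subset\mathbb{R}^d$ let $h_{X,\Omega}=\sup_{x\in\Omega}\min_{y\in X}\|x-y\|$ be the fill distance and $q_X=\frac12\min_{y\ne y'\in X}\|y-y'\|$ the separation distance. Let $\Omega_h\subset\mathbb{R}^d$ be a finite set of points, $\bm x_i\in\Omega_h$, $\varepsilon>0$, and let $M_i=\{\bm x_{ij}\}_{j=1}^N$ be the set of the midpoints $\bm x_{ij}=(\bm x_i+\bm x_j)/2$, $\bm x_j\in\Omega_h$, $\|\bm x_j-\bm x_i\|<\varepsilon$ (the degenerate edge $\bm x_j=\bm x_i$ may be either omitted or kept). Let $\Omega\subset\mathbb{R}^d$ be a region (for example a neighborhood of $\bm x_i$; $\Omega_h\subset\Omega$ is not required) with $\bm x_i\in\Omega$, let $\Phi$ be a real function on $[0,\infty)$, and assume: * **C.1** $\Omega$ is compact and satisfies the interior cone condition with radius $r>0$ and angle $\theta$: for every $\bm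 x\in\Omega$ there is a unit vector $\bm\xi$ with $\{\bm x+t\bm y: \|\bm y\|=1,\ \bm y\cdot\bm\xi\ge\cos\theta,\ 0\le t\le r\}\subset\Omega$. * **C.2** $M_i$ is a nonempty subset of $\Omega$, it is quasi-uniform with a constant $c$, i.e. $q_{M_i}\le h\le c\,q_{M_i}$, and $h\le r/C(\theta)$, where $h=h_{M_i,\Omega}$. * **C.3** With $\delta=2C(\theta)h$: $\Phi\ge0$, $\Phi(t)=0$ for $t>\delta$, and $\Phi(t)>0$ for $0\le t<\delta/2$. Let $P_m$ be the space of real polynomials on $\mathbb{R}^d$ of total degree at most $m$, $P=P_m^i=\{p\in P_m: p(\bm x_i)=0\}$, $\omega_j=\Phi(\|\bm x_i-\bm x_{ij}\|)$, and $\tau=\delta_{\bm x_i}\circ D^\alpha$. For $a\in\mathbb{R}^N$ consider the properties * **P.1** $D^\alpha p(\bm x_i)=\sum_{j=1}^N a_j\,p(\bm x_{ij})$ for all $p\in P$; * **P.2** $a_j=0$ whenever $\omega_j=0$; and also $a_j=0$ whenever $\|\bm x_i-\bm x_{ij}\|>2C(\theta)h$. Then there are a constant $C_0>0$ that depends only on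 $d,m,\theta,\alpha$, and constants $C_1(c,\varphi)>0$ that depend only on $d,m,\theta,\alpha$, on $c$ and on a function $\varphi:[0,\infty)\to\mathbb{R}$, such that for all data as above the following hold. 1. There exist coefficients $a_j=a_{ij,\alpha}(\bm x_i)$ with P.1, P.2 and the bound (P.3) $\sum_{j=1}^N|a_j|\le C_0\,h^{-|\alpha|}$. 2. The GMLS problem of minimizing $\frac12\sum_{j=1}^N a_j^2/\omega_j$ subject to P.1 (where $a_j^2/\omega_j$ for $\omega_j=0$ means $0$ if $a_j=0$ and $+\infty$ otherwise) has a unique solution $a$, and it satisfies P.2. If $\Phi(t)=\varphi(t/\delta)$ for all $t\ge0$ with $\varphi$ continuous, then it also satisfies $\sum_{j=1}^N|a_j|\le C_1(c,\varphi)\,h^{-|\alpha|}$. 3. For every real function $u$ on $\mathbb{R}^d$, the problem of minimizing $\frac12\sum_{j=1}^N\big(u(\bm x_{ij})-p(\bm x_{ij})\big)^2\omega_j$ over $p\in P$ has a unique solution $p^*$. For every basis $p_1,\dots,p_Q$ of $P$, the algebraic form of this problem, of minimizing $\frac12(\bm\ell-\mathsf P^T\bm c)^TW(\bm\ell-\mathsf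 P^T\bm c)$ over $\bm c\in\mathbb{R}^Q$ with $\bm\ell=(u(\bm x_{ij}))_j$, $\mathsf P=(p_k(\bm x_{ij}))_{k,j}$, $W=\mathrm{diag}(\omega_j)$, has a unique solution $\bm b$; moreover $p^*=\sum_k b_kp_k$, and the GMLS derivative that $\bm b$ defines satisfies $$\widetilde{D^\alpha}u(\bm x_i):=\sum_{k=1}^Q b_k\,D^\alpha p_k(\bm x_i)=\sum_{j=1}^N a_j\,u(\bm x_{ij}),$$ where $a$ is the solution of the GMLS problem in 2. -/

import Mathlib

noncomputable section

namespace GMLS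

/-! ### Geometry: cone condition, fill distance, quasi-uniformity, midpoints -/

/-- The Euclidean space `ℝ^d`. -/
abbrev E (d : ℕ) : Type := EuclideanSpace ℝ (Fin d)

/-- The cone with vertex `x`, axis `ξ` (a unit vector), angle `θ` and radius `r`. -/
def cone {d : ℕ} (x ξ : E d) (θ r : ℝ) : Set (E d) :=
  {z | ∃ (y : E d) (t : ℝ),
    ‖y‖ = 1 ∧ Real.cos θ ≤ inner ℝ y ξ ∧ 0 ≤ t ∧ t ≤ r ∧ z = x + t • y}

/-- Interior cone condition with radius `r` and angle `θ`. -/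
def InteriorCone {d : ℕ} (Ω : Set (E d)) (r θ : ℝ) : Prop :=
  ∀ x ∈ Ω, ∃ ξ : E d, ‖ξ‖ = 1 ∧ cone x ξ θ r ⊆ Ω

/-- Fill distance `h_{X,Ω} = sup_{x ∈ Ω} min_{y ∈ X} ‖x - y‖`
(used only for nonempty finite `X` and compact `Ω`). -/
def fillDistance {d : ℕ} (X Ω : Set (E d)) : ℝ :=
  sSup ((fun x => Metric.infDist x X) '' Ω)

/-- Separation distance `q_X = (1/2) min_{x ≠ y ∈ X} ‖x - y‖`. -/
def separationDistance {d : ℕ} (X : Set (E d)) : ℝ :=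
  Set.infsep X / 2

/-- `X` is quasi-uniform in `Ω` with constant `c`: `q_X ≤ h_{X,Ω} ≤ c q_X`. -/
def QuasiUniform {d : ℕ} (X Ω : Set (E d)) (c : ℝ) : Prop :=
  separationDistance X ≤ fillDistance X Ω ∧ fillDistance X Ω ≤ c * separationDistance X

/-- The constant `C(θ) = 16 (1 + sin θ)² m² / (3 sin² θ)`. -/
def coneConst (m : ℕ) (θ : ℝ) : ℝ :=
  16 * (1 + Real.sin θ) ^ 2 * (m : ℝ) ^ 2 / (3 * Real.sin θ ^ 2)

/-- The `ε`-neighborhood of `x` in the point set `Ωh`. -/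
def neighborhood {d : ℕ} (Ωh : Finset (E d)) (x : E d) (ε : ℝ) : Set (E d) :=
  {y | y ∈ Ωh ∧ ‖y - x‖ < ε}

/-- The midpoints of the nondegenerate edges that join `x` to the points of its
`ε`-neighborhood. -/
def edgeMidpoints {d : ℕ} (Ωh : Finset (E d)) (x : E d) (ε : ℝ) : Set (E d) :=
  {z | ∃ y ∈ neighborhood Ωh x ε, y ≠ x ∧ z = (1 / 2 : ℝ) • (x + y)}

/-- The region `Ω` is compact and satisfies an interior cone condition with radius `r > 0`
and angle `θ ∈ (0, π/2)`. -/
structure RegionCondition {d : ℕ} (Ω : Set (E d)) (r θ : ℝ) : Prop where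
  isCompact : IsCompact Ω
  r_pos : 0 < r
  θ_pos : 0 < θ
  θ_lt : θ < Real.pi / 2
  interiorCone : InteriorCone Ω r θ

/-- `X` is a (nonempty) finite subset of `Ω`, quasi-uniform with constant `c`, whose fill
distance is at most `h₀ = r / C(θ)`. -/
structure PointCondition {d : ℕ} (X : Finset (E d)) (Ω : Set (E d)) (m : ℕ) (r θ c : ℝ) :
    Prop where
  nonempty : X.Nonempty
  subset : (X : Set (E d)) ⊆ Ω
  quasiUniform : QuasiUniform (X : Set (E d)) Ω c
  fill_le : fillDistance (X : Set (E d)) Ω ≤ r / coneConst m θ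

/-- Condition on the (radial profile of the) weight function: it is nonnegative, vanishes
outside the ball of radius `δ` and is positive in the open ball of radius `δ / 2`. -/
structure WeightCondition (Φ : ℝ → ℝ) (δ : ℝ) : Prop where
  nonneg : ∀ t, 0 ≤ t → 0 ≤ Φ t
  support : ∀ t, δ < t → Φ t = 0
  pos : ∀ t, 0 ≤ t → t < δ / 2 → 0 < Φ t

/-! ### Polynomials and derivatives -/

/-- The linear map that sends a polynomial in `d` variables to its function on `ℝ^d`. -/
def polyFun (d : ℕ) : MvPolynomial (Fin d) ℝ →ₗ[ℝ] (E d → ℝ) :=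
  LinearMap.pi fun x => (MvPolynomial.aeval (fun i => x i)).toLinearMap

/-- `P_m`: polynomial functions on `ℝ^d` of total degree at most `m`. -/
def polySpace (d m : ℕ) : Submodule ℝ (E d → ℝ) :=
  (MvPolynomial.restrictTotalDegree (Fin d) ℝ m).map (polyFun d)

/-- The polynomial functions of degree at most `m` that vanish at `x`. -/
def polySpaceVanishing (d m : ℕ) (x : E d) : Submodule ℝ (E d → ℝ) :=
  polySpace d m ⊓ LinearMap.ker (LinearMap.proj x : (E d → ℝ) →ₗ[ℝ] ℝ)

/-- The partial derivative in the `j`-th coordinate direction. -/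
def partialD {d : ℕ} (j : Fin d) (f : E d → ℝ) : E d → ℝ :=
  fun x => lineDeriv ℝ f x (EuclideanSpace.single j 1)

/-- `D^α`, for a multi-index `α`. -/
def multiD {d : ℕ} (α : Fin d → ℕ) (f : E d → ℝ) : E d → ℝ :=
  (List.finRange d).foldr (fun j g => (partialD j)^[α j] g) f

/-- The order `|α|` of a multi-index. -/
def order {d : ℕ} (α : Fin d → ℕ) : ℕ := ∑ j, α j

/-! ### Generalized moving least squares

`V` is a space of functions, `P` the reproduction space, `lam i` are the sampling functionals,
`τ` is the target functional and `w i = ω(τ; lam i)` are the weights. -/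

section Abstract

variable {V ι : Type*} [AddCommGroup V] [Module ℝ V] [Fintype ι]

/-- The approximation `∑ a_i lam_i` of `τ` is exact on `P`. -/
def Reproduces (P : Submodule ℝ V) (lam : ι → V → ℝ) (τ : V → ℝ) (a : ι → ℝ) : Prop :=
  ∀ u ∈ P, τ u = ∑ i, a i * lam i u

/-- The coefficients have local supports relative to the weights. -/
def LocallySupported (w a : ι → ℝ) : Prop :=
  ∀ i, w i = 0 → a i = 0

/-- The objective `(1/2) ∑ a_i² / w_i` for nonnegative weights `w`. It takes values in `[0, ∞]`:
for `w_i = 0`, the quotient is `∞` if `a_i ≠ 0`, and `0` if `a_i = 0`. -/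
def qpObjective (w a : ι → ℝ) : ENNReal :=
  2⁻¹ * ∑ i, ENNReal.ofReal (a i ^ 2) / ENNReal.ofReal (w i)

/-- `a` solves the GMLS quadratic program: it minimizes the objective among all coefficient
vectors that are exact on `P`. -/
def IsQPSolution (P : Submodule ℝ V) (lam : ι → V → ℝ) (τ : V → ℝ) (w a : ι → ℝ) : Prop :=
  Reproduces P lam τ a ∧
    ∀ a' : ι → ℝ, Reproduces P lam τ a' → qpObjective w a ≤ qpObjective w a'

/-- The weighted least-squares functional `(1/2) ∑ (lam_i u - lam_i p)² w_i`. -/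
def lsObjective (lam : ι → V → ℝ) (w : ι → ℝ) (u p : V) : ℝ :=
  (1 / 2) * ∑ i, (lam i u - lam i p) ^ 2 * w i

/-- `p` is a best weighted least-squares fit out of `P` to the samples of `u`. -/
def IsLSFit (P : Submodule ℝ V) (lam : ι → V → ℝ) (w : ι → ℝ) (u p : V) : Prop :=
  p ∈ P ∧ ∀ q ∈ P, lsObjective lam w u p ≤ lsObjective lam w u q

/-- The matrix `P(Λ)` with entries `lam_i (p_k)`; rows are indexed by `k`, columns by `i`. -/
def sampleMatrix {Q : ℕ} (lam : ι → V → ℝ) (p : Fin Q → V) : Matrix (Fin Q) ι ℝ :=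
  Matrix.of fun k i => lam i (p k)

open Classical in
/-- The algebraic functional `(1/2) (ℓ(u) - P(Λ)ᵀ c)ᵀ W (ℓ(u) - P(Λ)ᵀ c)`, `W = diag(w)`. -/
def algObjective {Q : ℕ} (lam : ι → V → ℝ) (w : ι → ℝ) (p : Fin Q → V) (u : V)
    (c : Fin Q → ℝ) : ℝ :=
  let res : ι → ℝ := (fun i => lam i u) - (sampleMatrix lam p).transpose.mulVec c
  (1 / 2) * dotProduct res ((Matrix.diagonal w).mulVec res)

/-- `b` minimizes the algebraic least-squares functional over `ℝ^Q`. -/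
def IsAlgSolution {Q : ℕ} (lam : ι → V → ℝ) (w : ι → ℝ) (p : Fin Q → V) (u : V)
    (b : Fin Q → ℝ) : Prop :=
  ∀ c : Fin Q → ℝ, algObjective lam w p u b ≤ algObjective lam w p u c

end Abstract

/-! ### Specialization to point samples and derivatives at a point -/

/-- Point evaluations at the points of `X`. -/
def pointSamples {d : ℕ} (X : Finset (E d)) : X → (E d → ℝ) → ℝ :=
  fun y u => u y

/-- The weights `Φ(‖x - y‖)`, `y ∈ X`. -/
def pointWeights {d : ℕ} (Φ : ℝ → ℝ) (x : E d) (X : Finset (E d)) : X → ℝ :=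
  fun y => Φ ‖x - (y : E d)‖

/-- The target functional `δ_x ∘ D^α`. -/
def derivTarget {d : ℕ} (x : E d) (α : Fin d → ℕ) : (E d → ℝ) → ℝ :=
  fun u => multiD α u x

/-- The GMLS derivative `∑ b_k D^α p_k (x)` determined by a coefficient vector `b` relative
to the functions `p_k`. -/
def gmlsDerivative {d Q : ℕ} (x : E d) (α : Fin d → ℕ) (p : Fin Q → E d → ℝ)
    (b : Fin Q → ℝ) : ℝ :=
  ∑ k, b k * derivTarget x α (p k)

end GMLS

end

/-! The core is a norming-set argument. The cone at `x` contains a ball of radius `ρ ≥ h` at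
distance `ρ / sin θ` from `x`. Let `|f|`, for a polynomial `f` of degree at most `m`, attain its
maximum over this ball at `z`. By Markov's inequality along segments that start at `z`, `|f|` stays
above half the maximum on an initial portion of each of them. These portions fill a ball of radius
at least `h`, which contains a sample point, so the samples within `C(θ) h / 2` of `x` control `f`
up to a factor 2 (`exists_norming_ball`).

Rescaling to the unit ball, where all norms on polynomials are equivalent, bounds `D^α f (x)` by a
constant times `h ^ (-|α|)` times the largest sample. Hahn-Banach in the sup norm of the samples,
whose dual norm is the `ℓ¹` norm, turns this into coefficients with P.1 to P.3
(`exists_local_reproduction`). Since `C(θ) h / 2 = δ / 4`, these samples have positive weight. Hence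
the weighted Gram form on `P` is positive definite, which gives existence, uniqueness and duality of
the quadratic program and the least squares fit (`Unisolvent.exists_gmls`).

The optimal coefficients have weighted norm at most that of the reproducing ones. Cauchy-Schwarz, a
packing bound on the number of samples in the support and a positive lower bound of the profile on
`[0, 1/4]` convert this into an `ℓ¹` bound (`exists_weight_factor`). -/

namespace GMLS

/-! ### Markov's inequality for univariate polynomials -/

open Polynomial in
/-- Markov's inequality at an endpoint of an interval, for derivatives of univariate polynomials. -/
lemma abs_eval_derivative_le_of_abs_eval_le {n : ℕ} {q : ℝ[X]} (hq : q.natDegree ≤ n) {B t : ℝ}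
    (ht : t < 1) (hB : ∀ y ∈ Set.Icc t 1, |q.eval y| ≤ B) :
    |(derivative q).eval t| ≤ B * (2 * (n : ℝ) ^ 2 / (1 - t)) := by
  have ht' : 0 < 1 - t := by linarith
  have key : ∀ p : ℝ[X], p.natDegree ≤ n → (∀ y ∈ Set.Icc t 1, |p.eval y| ≤ 1) →
      -(derivative p).eval t ≤ 2 * (n : ℝ) ^ 2 / (1 - t) := by
    intro p hp hp1
    -- `l` maps `[-1, 1]` onto `[t, 1]` with reversed orientation, so `t` is the image of `1`, where
    -- the Chebyshev polynomial has the extremal derivative `n ^ 2`.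
    set l : ℝ[X] := C ((1 + t) / 2) - C ((1 - t) / 2) * X with hl
    have hl1 : l.natDegree ≤ 1 := by rw [hl]; compute_degree
    have hdeg : (p.comp l).degree ≤ n := by
      refine degree_le_of_natDegree_le (natDegree_comp_le.trans ?_)
      calc _ ≤ n * 1 := Nat.mul_le_mul hp hl1
        _ = n := mul_one n
    have hbd : ∀ y ∈ Set.Icc (-1 : ℝ) 1, |(p.comp l).eval y| ≤ 1 := by
      rintro y ⟨hy1, hy2⟩
      rw [eval_comp]
      refine hp1 _ ?_
      simp only [hl, eval_sub, eval_mul, eval_C, eval_X]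
      constructor <;> nlinarith
    have h := Chebyshev.eval_iterate_derivative_le_of_forall_abs_le_one (k := 1) le_rfl hdeg hbd
    simp only [Function.iterate_one, Chebyshev.derivative_T_eval_one, derivative_comp, eval_mul,
      eval_comp] at h
    simp only [hl, derivative_sub, derivative_mul, derivative_C, derivative_X, eval_sub, eval_mul,
      eval_C, eval_X, eval_add, eval_zero, eval_one] at h
    rw [show (1 + t) / 2 - (1 - t) / 2 * 1 = t by ring] at h
    rw [le_div_iff₀ ht']
    push_cast at h
    nlinarith
  have hB0 : 0 ≤ B := (abs_nonneg _).trans (hB t ⟨le_rfl, ht.le⟩)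
  rcases hB0.eq_or_lt with rfl | hBpos
  · have hzero : q = 0 := by
      refine eq_zero_of_infinite_isRoot q ((Set.Icc_infinite ht).mono fun y hy => ?_)
      exact abs_eq_zero.1 (le_antisymm (hB y hy) (abs_nonneg _))
    simp [hzero]
  -- The estimate `key` is one-sided; applying it to `q / B` and to `-q / B` gives both signs.
  · have scaled : ∀ s : ℝ, |s| = 1 →
        -(s * (derivative q).eval t) ≤ B * (2 * (n : ℝ) ^ 2 / (1 - t)) := by
      intro s hs
      have h := key (C (s * B⁻¹) * q) ((natDegree_C_mul_le _ _).trans hq) (fun y hy => by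
        rw [eval_mul, eval_C, abs_mul, abs_mul, hs, one_mul, abs_inv, abs_of_pos hBpos,
          inv_mul_le_iff₀ hBpos, mul_one]
        exact hB y hy)
      simp only [derivative_C_mul, eval_mul, eval_C] at h
      have h' := mul_le_mul_of_nonneg_left h hBpos.le
      calc _ = B * -(s * B⁻¹ * (derivative q).eval t) := by field_simp
        _ ≤ _ := h'
    have h1 := scaled 1 (by simp)
    have h2 := scaled (-1) (by simp)
    rw [abs_le]
    constructor <;> linarith

open Polynomial in
/-- A polynomial that attains its maximal modulus over `[0, 1]` at `0` stays large near `0`. -/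
lemma half_le_abs_eval_of_maximal_at_zero {n : ℕ} (hn : 0 < n) {q : ℝ[X]} (hq : q.natDegree ≤ n)
    {B s : ℝ} (hB : ∀ y ∈ Set.Icc (0 : ℝ) 1, |q.eval y| ≤ B) (h0 : |q.eval 0| = B)
    (hs0 : 0 ≤ s) (hs : s ≤ 3 / (16 * (n : ℝ) ^ 2)) : B / 2 ≤ |q.eval s| := by
  have hn1 : (1 : ℝ) ≤ (n : ℝ) ^ 2 := one_le_pow₀ (by exact_mod_cast hn)
  have hB0 : 0 ≤ B := h0 ▸ abs_nonneg _
  have hsn : s * (16 * (n : ℝ) ^ 2) ≤ 3 := (le_div_iff₀ (by positivity)).1 hs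
  have hs16 : s ≤ 3 / 16 := by nlinarith
  -- Markov's inequality on `[t, 1]`, whose length is at least `13/16`. Over `[0, s]` the polynomial
  -- then changes by at most `(6/13) B < B/2` when `B > 0`.
  have hder : ∀ t ∈ Set.Icc (0 : ℝ) s, ‖deriv (fun y => q.eval y) t‖
      ≤ B * (2 * (n : ℝ) ^ 2 * (16 / 13)) := by
    rintro t ⟨ht0, hts⟩
    rw [Polynomial.deriv, Real.norm_eq_abs]
    refine (abs_eval_derivative_le_of_abs_eval_le hq (by linarith)
      fun y hy => hB y ⟨ht0.trans hy.1, hy.2⟩).trans ?_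
    gcongr
    rw [div_le_iff₀ (by linarith)]
    have : (0 : ℝ) ≤ 2 * (n : ℝ) ^ 2 := by positivity
    nlinarith
  have h := (convex_Icc (0 : ℝ) s).norm_image_sub_le_of_norm_deriv_le
    (fun t _ => q.differentiable t) hder ⟨le_rfl, hs0⟩ ⟨hs0, le_rfl⟩
  rw [Real.norm_eq_abs, Real.norm_eq_abs, sub_zero, abs_of_nonneg hs0] at h
  have h' : B * (2 * (n : ℝ) ^ 2 * (16 / 13)) * s ≤ B / 2 := by
    nlinarith [mul_le_mul_of_nonneg_left hsn hB0]
  have := abs_sub_abs_le_abs_sub (q.eval 0) (q.eval s)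
  rw [abs_sub_comm, h0] at this
  linarith

/-! ### Polynomial functions -/

@[simp] lemma polyFun_apply {d : ℕ} (F : MvPolynomial (Fin d) ℝ) (x : E d) :
    polyFun d F x = MvPolynomial.aeval (fun i => x i) F := rfl

lemma mem_polySpace {d m : ℕ} {f : E d → ℝ} :
    f ∈ polySpace d m ↔ ∃ F : MvPolynomial (Fin d) ℝ, F.totalDegree ≤ m ∧ polyFun d F = f := by
  simp only [polySpace, Submodule.mem_map, MvPolynomial.mem_restrictTotalDegree]

instance (d m : ℕ) : Module.Finite ℝ (polySpace d m) := by
  unfold polySpace; infer_instance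

instance (d m : ℕ) (x : E d) : Module.Finite ℝ (polySpaceVanishing d m x) :=
  Submodule.finiteDimensional_of_le (inf_le_left : polySpaceVanishing d m x ≤ polySpace d m)

lemma continuous_polyFun {d : ℕ} (F : MvPolynomial (Fin d) ℝ) : Continuous (polyFun d F) := by
  have : polyFun d F = fun x : E d => MvPolynomial.eval (fun i => x i) F := by
    ext x; simp [MvPolynomial.aeval_eq_eval]
  rw [this]
  exact (MvPolynomial.continuous_eval F).comp (by fun_prop)

lemma continuous_of_mem_polySpace {d m : ℕ} {f : E d → ℝ} (hf : f ∈ polySpace d m) :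
    Continuous f := by
  obtain ⟨F, -, rfl⟩ := mem_polySpace.1 hf
  exact continuous_polyFun F

/-- Restriction to lines is the way in which univariate facts enter. -/
lemma exists_polynomial_of_mem_polySpace {d m : ℕ} {f : E d → ℝ} (hf : f ∈ polySpace d m)
    (z v : E d) : ∃ q : Polynomial ℝ, q.natDegree ≤ m ∧ ∀ t : ℝ, q.eval t = f (z + t • v) := by
  obtain ⟨F, hF, rfl⟩ := mem_polySpace.1 hf
  refine ⟨MvPolynomial.aeval (fun i => Polynomial.C (z i) + Polynomial.C (v i) * Polynomial.X) F,
    ?_, fun t => ?_⟩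
  · refine (MvPolynomial.aeval_natDegree_le F hF _ (n := 1) fun i => ?_).trans (mul_one m).le
    compute_degree
  · rw [← Polynomial.coe_aeval_eq_eval, MvPolynomial.comp_aeval_apply, polyFun_apply]
    congr 2
    ext i
    simp [mul_comm (v i)]

lemma totalDegree_aeval_le {σ : Type*} {m : ℕ} (F : MvPolynomial σ ℝ) (hF : F.totalDegree ≤ m)
    (g : σ → MvPolynomial σ ℝ) (hg : ∀ i, (g i).totalDegree ≤ 1) :
    (MvPolynomial.aeval g F).totalDegree ≤ m := by
  rw [MvPolynomial.aeval_def, MvPolynomial.eval₂]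
  refine (MvPolynomial.totalDegree_finsetSum _ _).trans (Finset.sup_le fun e he => ?_)
  refine (MvPolynomial.totalDegree_mul _ _).trans ?_
  rw [MvPolynomial.algebraMap_eq, MvPolynomial.totalDegree_C, zero_add]
  refine (MvPolynomial.totalDegree_finsetProd _ _).trans ?_
  refine le_trans (Finset.sum_le_sum fun i _ => ?_) ((MvPolynomial.le_totalDegree he).trans hF)
  exact (MvPolynomial.totalDegree_pow _ _).trans
    ((Nat.mul_le_mul_left _ (hg i)).trans (mul_one _).le)

lemma comp_affine_mem_polySpace {d m : ℕ} {f : E d → ℝ} (hf : f ∈ polySpace d m) (z : E d)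
    (c : ℝ) : (fun y => f (z + c • y)) ∈ polySpace d m := by
  obtain ⟨F, hF, rfl⟩ := mem_polySpace.1 hf
  refine mem_polySpace.2 ⟨MvPolynomial.aeval (fun i => MvPolynomial.C (z i) +
    MvPolynomial.C c * MvPolynomial.X i) F, totalDegree_aeval_le F hF _ fun i => ?_, ?_⟩
  · refine (MvPolynomial.totalDegree_add _ _).trans (max_le (by simp) ?_)
    refine (MvPolynomial.totalDegree_mul _ _).trans (by simp)
  · ext y
    rw [polyFun_apply, MvPolynomial.comp_aeval_apply, polyFun_apply]
    simp

/-- On the line from the centre `z` through `y`, the restriction has infinitely many zeros near `z`,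
hence vanishes identically, in particular at `y`. -/
lemma eq_zero_of_mem_polySpace_of_ball {d m : ℕ} {f : E d → ℝ} (hf : f ∈ polySpace d m) {z : E d}
    {r : ℝ} (hr : 0 < r) (h : ∀ y ∈ Metric.closedBall z r, f y = 0) : f = 0 := by
  ext y
  obtain ⟨q, -, hq⟩ := exists_polynomial_of_mem_polySpace hf z (y - z)
  have hq0 : q = 0 := by
    have hpos : 0 < r / (1 + ‖y - z‖) := by positivity
    refine Polynomial.eq_zero_of_infinite_isRoot q ((Set.Icc_infinite hpos).mono fun t ht => ?_)
    rw [Set.mem_ofPred_eq, Polynomial.IsRoot.def, hq]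
    refine h _ ?_
    rw [Metric.mem_closedBall, dist_eq_norm, add_sub_cancel_left, norm_smul, Real.norm_eq_abs,
      abs_of_nonneg ht.1]
    have := (le_div_iff₀ (by positivity)).1 ht.2
    nlinarith [ht.1, norm_nonneg (y - z)]
  have := hq 1
  rw [hq0] at this
  simpa using this.symm

/-! ### Derivatives of polynomial functions -/

lemma partialD_polyFun {d : ℕ} (j : Fin d) (F : MvPolynomial (Fin d) ℝ) :
    partialD j (polyFun d F) = polyFun d (MvPolynomial.pderiv j F) := by
  ext x
  refine HasLineDerivAt.lineDeriv ?_
  unfold HasLineDerivAt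
  induction F using MvPolynomial.induction_on with
  | C a => simpa using hasDerivAt_const (0 : ℝ) a
  | add p q hp hq => simpa [Pi.add_def] using hp.add hq
  | mul_X p i hp =>
    have hX : HasDerivAt (fun t : ℝ => (x + t • EuclideanSpace.single j (1 : ℝ)) i)
        (if i = j then 1 else 0) 0 := by
      have := ((hasDerivAt_id (0 : ℝ)).mul_const (if i = j then (1 : ℝ) else 0)).const_add (x i)
      simpa [Pi.single_apply] using this
    have := hp.mul hX
    refine (this.congr_deriv ?_).congr_of_eventuallyEq (.of_forall fun t => by simp)
    by_cases hij : i = j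
    · subst hij; simp; ring
    · simp [hij, mul_comm]

/-- `D^α` on polynomial functions comes from a linear map of polynomials. -/
lemma exists_multiD_polyFun {d : ℕ} (α : Fin d → ℕ) :
    ∃ D : MvPolynomial (Fin d) ℝ →ₗ[ℝ] MvPolynomial (Fin d) ℝ,
      ∀ F, multiD α (polyFun d F) = polyFun d (D F) := by
  unfold multiD
  induction List.finRange d with
  | nil => exact ⟨LinearMap.id, fun F => rfl⟩
  | cons j l ih =>
    obtain ⟨D, hD⟩ := ih
    refine ⟨((MvPolynomial.pderiv j).toLinearMap ^ α j) ∘ₗ D, fun F => ?_⟩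
    rw [List.foldr_cons, hD, LinearMap.comp_apply]
    generalize D F = G
    induction α j with
    | zero => simp
    | succ k ih =>
      rw [Function.iterate_succ_apply', ih, partialD_polyFun, pow_succ']
      rfl

/-- `lineDeriv` has a default value where the derivative does not exist, so additivity is claimed
only for polynomial functions, on which `D^α` is a genuine linear map. -/
lemma multiD_add {d m : ℕ} (α : Fin d → ℕ) {f g : E d → ℝ} (hf : f ∈ polySpace d m)
    (hg : g ∈ polySpace d m) : multiD α (f + g) = multiD α f + multiD α g := by
  obtain ⟨D, hD⟩ := exists_multiD_polyFun α
  obtain ⟨F, -, rfl⟩ := mem_polySpace.1 hf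
  obtain ⟨G, -, rfl⟩ := mem_polySpace.1 hg
  rw [← map_add, hD, hD, hD, map_add, map_add]

lemma multiD_smul {d m : ℕ} (α : Fin d → ℕ) (c : ℝ) {f : E d → ℝ} (hf : f ∈ polySpace d m) :
    multiD α (c • f) = c • multiD α f := by
  obtain ⟨D, hD⟩ := exists_multiD_polyFun α
  obtain ⟨F, -, rfl⟩ := mem_polySpace.1 hf
  rw [← map_smul, hD, hD, map_smul, map_smul]

/-- The scaling rules of `deriv` over a field hold without differentiability, so `f` is arbitrary.
The factor `a` accumulates the powers of `c` under iteration. -/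
lemma partialD_comp_affine {d : ℕ} (j : Fin d) (f : E d → ℝ) (a c : ℝ) (z : E d) :
    partialD j (fun y => a * f (z + c • y)) = fun y => a * c * partialD j f (z + c • y) := by
  ext y
  unfold partialD lineDeriv
  have h := deriv_comp_mul_left c
    (fun t : ℝ => a * f (z + c • y + t • EuclideanSpace.single j (1 : ℝ))) 0
  simp only [mul_zero, deriv_const_mul_field, smul_eq_mul] at h
  rw [mul_assoc, mul_left_comm, ← h, ← deriv_const_mul_field]
  congr 1
  ext t
  dsimp only
  rw [smul_add, smul_smul, add_assoc]

lemma multiD_comp_affine {d : ℕ} (α : Fin d → ℕ) (f : E d → ℝ) (z : E d) (c : ℝ) :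
    multiD α (fun y => f (z + c • y)) = fun y => c ^ order α * multiD α f (z + c • y) := by
  have iter : ∀ (j : Fin d) (k : ℕ) (a : ℝ) (g : E d → ℝ),
      (partialD j)^[k] (fun y => a * g (z + c • y))
        = fun y => a * c ^ k * (partialD j)^[k] g (z + c • y) := by
    intro j k a g
    induction k with
    | zero => simp
    | succ k ih =>
      rw [Function.iterate_succ_apply', ih, partialD_comp_affine, Function.iterate_succ_apply']
      ext y
      ring
  have hsum : order α = ((List.finRange d).map α).sum := by
    rw [order, ← List.sum_ofFn, List.ofFn_eq_map]
  rw [hsum]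
  unfold multiD
  induction List.finRange d with
  | nil => simp
  | cons j l ih =>
    rw [List.foldr_cons, ih, iter, List.foldr_cons, List.map_cons, List.sum_cons, pow_add]
    ext y
    ring

/-- A linear map on a finite-dimensional space is bounded by any injective linear map. -/
lemma exists_norm_le_mul_norm {P A B : Type*} [AddCommGroup P] [Module ℝ P] [Module.Finite ℝ P]
    [NormedAddCommGroup A] [NormedSpace ℝ A] [NormedAddCommGroup B] [NormedSpace ℝ B]
    (J : P →ₗ[ℝ] A) (G : P →ₗ[ℝ] B) (hJ : LinearMap.ker J = ⊥) :
    ∃ K : ℝ, 0 < K ∧ ∀ f, ‖G f‖ ≤ K * ‖J f‖ := by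
  let e := LinearEquiv.ofInjective J (LinearMap.ker_eq_bot.1 hJ)
  -- The map `J f ↦ G f` is bounded because the range of `J` is finite-dimensional.
  let T := LinearMap.toContinuousLinearMap (G ∘ₗ e.symm.toLinearMap)
  refine ⟨‖T‖ + 1, by positivity, fun f => ?_⟩
  have h : T (e f) = G f := congrArg G (e.symm_apply_apply f)
  calc ‖G f‖ = ‖T (e f)‖ := by rw [h]
    _ ≤ ‖T‖ * ‖e f‖ := T.le_opNorm _
    _ ≤ (‖T‖ + 1) * ‖J f‖ := mul_le_mul_of_nonneg_right (by linarith) (norm_nonneg _)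

/-- Derivatives of a polynomial on a ball are bounded by its values on the unit ball. -/
lemma exists_multiD_bound (d m : ℕ) (α : Fin d → ℕ) (R : ℝ) :
    ∃ K : ℝ, 0 < K ∧ ∀ f ∈ polySpace d m, ∀ B : ℝ, 0 ≤ B →
      (∀ y ∈ Metric.closedBall (0 : E d) 1, |f y| ≤ B) →
      ∀ z ∈ Metric.closedBall (0 : E d) R, |multiD α f z| ≤ K * B := by
  obtain ⟨D, hD⟩ := exists_multiD_polyFun α
  have : CompactSpace (Metric.closedBall (0 : E d) 1) :=
    isCompact_iff_compactSpace.1 (isCompact_closedBall _ _)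
  have : CompactSpace (Metric.closedBall (0 : E d) R) :=
    isCompact_iff_compactSpace.1 (isCompact_closedBall _ _)
  have hcD : ∀ f : polySpace d m, Continuous (multiD α f.1) := by
    rintro ⟨f, hf⟩
    obtain ⟨F, -, rfl⟩ := mem_polySpace.1 hf
    rw [hD]
    exact continuous_polyFun _
  let J : polySpace d m →ₗ[ℝ] C(Metric.closedBall (0 : E d) 1, ℝ) :=
    { toFun := fun f => ⟨fun y => f.1 y,
        (continuous_of_mem_polySpace f.2).comp continuous_subtype_val⟩
      map_add' := fun _ _ => rfl
      map_smul' := fun _ _ => rfl }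
  let G : polySpace d m →ₗ[ℝ] C(Metric.closedBall (0 : E d) R, ℝ) :=
    { toFun := fun f => ⟨fun y => multiD α f.1 y, (hcD f).comp continuous_subtype_val⟩
      map_add' := fun f g => by ext y; exact congrFun (multiD_add α f.2 g.2) y
      map_smul' := fun c f => by ext y; exact congrFun (multiD_smul α c f.2) y }
  have hJ : LinearMap.ker J = ⊥ := by
    rw [LinearMap.ker_eq_bot']
    rintro ⟨f, hf⟩ h
    refine Subtype.ext (eq_zero_of_mem_polySpace_of_ball hf (z := 0) one_pos fun y hy => ?_)
    exact DFunLike.congr_fun h ⟨y, hy⟩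
  obtain ⟨K, hK, hKb⟩ := exists_norm_le_mul_norm J G hJ
  refine ⟨K, hK, fun f hf B hB hfB z hz => ?_⟩
  have h2 : ‖J ⟨f, hf⟩‖ ≤ B := (ContinuousMap.norm_le _ hB).2 fun y => hfB y y.2
  calc |multiD α f z| = ‖G ⟨f, hf⟩ ⟨z, hz⟩‖ := rfl
    _ ≤ ‖G ⟨f, hf⟩‖ := ContinuousMap.norm_coe_le_norm _ _
    _ ≤ K * ‖J ⟨f, hf⟩‖ := hKb _
    _ ≤ K * B := by gcongr

/-! ### Coefficients with a bounded `ℓ¹`-norm -/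

section Coefficients

variable {V ι : Type*} [AddCommGroup V] [Module ℝ V] [Fintype ι]

/-- A functional bounded by the maximum of the samples is a combination of the samples whose
coefficients have the same bound. -/
lemma exists_coeff_of_norming (L : ι → V →ₗ[ℝ] ℝ) (τ : V →ₗ[ℝ] ℝ) {K : ℝ} (hK : 0 ≤ K)
    (h : ∀ p, |τ p| ≤ K * ‖fun i => L i p‖) :
    ∃ a : ι → ℝ, (∀ p, τ p = ∑ i, a i * L i p) ∧ ∑ i, |a i| ≤ K := by
  classical
  let T : V →ₗ[ℝ] (ι → ℝ) := LinearMap.pi L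
  obtain ⟨s, hs⟩ := T.rangeRestrict.exists_rightInverse_of_surjective T.range_rangeRestrict
  have hTs : ∀ w, T (s w) = w := fun w => congrArg Subtype.val (LinearMap.congr_fun hs w)
  let g : LinearMap.range T →L[ℝ] ℝ := (τ ∘ₗ s).mkContinuous K fun w => by
    have := h (s w)
    rwa [show (fun i => L i (s w)) = (w : ι → ℝ) from hTs w] at this
  -- `τ` depends only on the samples: by the hypothesis it vanishes on an element whose samples are
  -- all zero.
  have hg : ∀ p, g (T.rangeRestrict p) = τ p := by
    intro p
    have h0 : |τ (s (T.rangeRestrict p) - p)| ≤ 0 := by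
      refine (h _).trans_eq ?_
      have : (fun i => L i (s (T.rangeRestrict p) - p)) = T (s (T.rangeRestrict p) - p) := rfl
      rw [this, map_sub, hTs]
      simp
    rw [abs_nonpos_iff, map_sub, sub_eq_zero] at h0
    exact h0
  obtain ⟨f, hf, hfn⟩ := exists_extension_norm_eq (LinearMap.range T) g
  have hfe : ∀ v : ι → ℝ, f v = ∑ i, f (Pi.single i 1) * v i := by
    intro v
    conv_lhs => rw [← Finset.univ_sum_single v, map_sum]
    refine Finset.sum_congr rfl fun i _ => ?_
    rw [mul_comm, ← smul_eq_mul, ← map_smul, ← Pi.single_smul', smul_eq_mul, mul_one]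
  refine ⟨fun i => f (Pi.single i 1), fun p => ?_, ?_⟩
  · rw [← hg, ← hf, hfe]
    rfl
  -- The `ℓ¹` norm of the coefficients is the value of `f` at their sign vector, which lies in the
  -- unit ball of the sup norm.
  · have h1 : ∑ i, |f (Pi.single i 1)| = f fun i => SignType.sign (f (Pi.single i (1 : ℝ))) := by
      rw [hfe]
      exact Finset.sum_congr rfl fun i _ => (self_mul_sign _).symm
    rw [h1]
    refine (le_abs_self _).trans ((f.le_opNorm _).trans ?_)
    have h2 : ‖f‖ ≤ K := hfn.trans_le (LinearMap.mkContinuous_norm_le _ hK _)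
    have h3 : ‖fun i => (SignType.sign (f (Pi.single i (1 : ℝ))) : ℝ)‖ ≤ 1 := by
      refine (pi_norm_le_iff_of_nonneg zero_le_one).2 fun i => ?_
      cases SignType.sign (f (Pi.single i (1 : ℝ))) <;> simp
    exact (mul_le_mul h2 h3 (norm_nonneg _) hK).trans_eq (mul_one K)

end Coefficients

/-! ### The quadratic program and the weighted least squares problem -/

section LeastSquares

variable {V ι : Type*} [AddCommGroup V] [Module ℝ V] [Fintype ι]

/-- Where the weight is zero, both the extended and the real quotient have numerator `0` and value
`0`, so the objective reduces to a real sum. -/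
lemma qpObjective_of_locallySupported {w a : ι → ℝ} (hw : ∀ i, 0 ≤ w i)
    (ha : LocallySupported w a) :
    qpObjective w a = 2⁻¹ * ENNReal.ofReal (∑ i, a i ^ 2 / w i) := by
  rw [qpObjective, ENNReal.ofReal_sum_of_nonneg fun i _ => div_nonneg (sq_nonneg _) (hw i)]
  congr 1
  refine Finset.sum_congr rfl fun i _ => ?_
  rcases (hw i).eq_or_lt with h | h
  · simp [← h, ha i h.symm]
  · rw [ENNReal.ofReal_div_of_pos h]

lemma qpObjective_eq_top {w a : ι → ℝ} (ha : ¬ LocallySupported w a) : qpObjective w a = ⊤ := by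
  simp only [LocallySupported, not_forall] at ha
  obtain ⟨i, hi, hai⟩ := ha
  have htop : ENNReal.ofReal (a i ^ 2) / ENNReal.ofReal (w i) = ⊤ := by
    rw [hi, ENNReal.ofReal_zero, ENNReal.div_zero]
    simpa using hai
  have hsum : ∑ i, ENNReal.ofReal (a i ^ 2) / ENNReal.ofReal (w i) = ⊤ :=
    ENNReal.sum_eq_top.2 ⟨i, Finset.mem_univ i, htop⟩
  rw [qpObjective, hsum]
  exact ENNReal.mul_top (by simp)

/-- The samples that carry a positive weight determine the elements of `P`. -/
def Unisolvent (P : Submodule ℝ V) (L : ι → V →ₗ[ℝ] ℝ) (w : ι → ℝ) : Prop :=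
  ∀ p ∈ P, (∀ i, 0 < w i → L i p = 0) → p = 0

variable {P : Submodule ℝ V} {L : ι → V →ₗ[ℝ] ℝ} {w : ι → ℝ}

lemma Unisolvent.eq_zero_of_sum_sq (hU : Unisolvent P L w) (hw : ∀ i, 0 ≤ w i) {p : V}
    (hp : p ∈ P) (h : ∑ i, w i * L i p ^ 2 = 0) : p = 0 := by
  refine hU p hp fun i hi => ?_
  have := (Finset.sum_eq_zero_iff_of_nonneg
    fun i _ => mul_nonneg (hw i) (sq_nonneg (L i p))).1 h i (Finset.mem_univ i)
  simpa [hi.ne'] using this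

/-- The normal equations are solvable for every right-hand side. -/
lemma Unisolvent.exists_gram [Module.Finite ℝ P] (hU : Unisolvent P L w) (hw : ∀ i, 0 ≤ w i)
    (g : P →ₗ[ℝ] ℝ) : ∃ p ∈ P, ∀ q : P, ∑ i, w i * L i p * L i q = g q := by
  let G : P →ₗ[ℝ] Module.Dual ℝ P :=
    ∑ i, ((L i ∘ₗ P.subtype).smulRight (w i • (L i ∘ₗ P.subtype)))
  have hG : ∀ p q : P, G p q = ∑ i, w i * L i p * L i q := by
    intro p q
    simp only [G, LinearMap.sum_apply, LinearMap.smulRight_apply, LinearMap.smul_apply,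
      LinearMap.comp_apply, Submodule.subtype_apply, smul_eq_mul]
    exact Finset.sum_congr rfl fun i _ => by ring
  -- `G p = 0` makes `G p p`, a weighted sum of squares of samples, vanish. Equality of dimensions
  -- then upgrades injectivity to surjectivity.
  have hinj : Function.Injective G := by
    rw [injective_iff_map_eq_zero]
    intro p hp
    refine Subtype.ext (hU.eq_zero_of_sum_sq hw p.2 ?_)
    rw [← LinearMap.zero_apply (σ₁₂ := RingHom.id ℝ) p, ← hp, hG]
    exact Finset.sum_congr rfl fun i _ => by ring
  have hsurj : Function.Surjective G :=
    (LinearMap.injective_iff_surjective_of_finrank_eq_finrank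
      Subspace.dual_finrank_eq.symm).1 hinj
  obtain ⟨p, hp⟩ := hsurj g
  exact ⟨p, p.2, fun q => by rw [← hp, hG]⟩

/-- Coefficients of the form `w i * L i p` are optimal, with a quadratic gap. -/
lemma sum_sq_div_eq_add {τ : V → ℝ} {a a' : ι → ℝ} {p : V} (hp : p ∈ P)
    (hap : ∀ i, a i = w i * L i p) (ha : Reproduces P (fun i => L i) τ a)
    (ha' : Reproduces P (fun i => L i) τ a') (hs : LocallySupported w a') :
    ∑ i, a' i ^ 2 / w i = ∑ i, a i ^ 2 / w i + ∑ i, (a' i - a i) ^ 2 / w i := by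
  -- Both vectors are exact at `p ∈ P`, so their difference is orthogonal to its samples; this
  -- removes the cross term.
  have horth : ∑ i, (a' i - a i) * L i p = 0 := by
    have h := (ha' p hp).symm.trans (ha p hp)
    simp only [sub_mul, Finset.sum_sub_distrib]
    exact sub_eq_zero.2 h
  have hpt : ∀ i, a' i ^ 2 / w i
      = a i ^ 2 / w i + (a' i - a i) ^ 2 / w i + 2 * ((a' i - a i) * L i p) := by
    intro i
    by_cases hi : w i = 0
    · simp [hs i hi, hap i, hi]
    · rw [hap i]
      field_simp
      ring
  rw [Finset.sum_congr rfl fun i _ => hpt i, Finset.sum_add_distrib, Finset.sum_add_distrib,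
    ← Finset.mul_sum, horth, mul_zero, add_zero]

/-- The form `w i * L i p` is the stationarity condition with Lagrange multiplier `p`. The quadratic
gap makes it sufficient and yields uniqueness; competitors that are not locally supported cost `∞`.
-/
lemma isQPSolution_of_eq {τ : V → ℝ} {a : ι → ℝ} (hw : ∀ i, 0 ≤ w i) {p : V} (hp : p ∈ P)
    (hap : ∀ i, a i = w i * L i p) (ha : Reproduces P (fun i => L i) τ a) :
    IsQPSolution P (fun i => L i) τ w a ∧
      ∀ a', IsQPSolution P (fun i => L i) τ w a' → a' = a := by
  have hsa : LocallySupported w a := fun i hi => by rw [hap, hi, zero_mul]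
  have hnn : ∀ b : ι → ℝ, 0 ≤ ∑ i, b i ^ 2 / w i := fun b =>
    Finset.sum_nonneg fun i _ => div_nonneg (sq_nonneg _) (hw i)
  refine ⟨⟨ha, fun a' ha' => ?_⟩, fun a' ha' => ?_⟩
  · by_cases hs : LocallySupported w a'
    · rw [qpObjective_of_locallySupported hw hsa, qpObjective_of_locallySupported hw hs]
      refine mul_le_mul_right (ENNReal.ofReal_le_ofReal ?_) _
      rw [sum_sq_div_eq_add hp hap ha ha' hs]
      exact le_add_of_nonneg_right (hnn fun i => a' i - a i)
    · rw [qpObjective_eq_top hs]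
      exact le_top
  · have hle := ha'.2 a ha
    have hs : LocallySupported w a' := by
      by_contra hs
      rw [qpObjective_eq_top hs, qpObjective_of_locallySupported hw hsa, top_le_iff] at hle
      exact ENNReal.mul_ne_top (by simp) ENNReal.ofReal_ne_top hle
    rw [qpObjective_of_locallySupported hw hsa, qpObjective_of_locallySupported hw hs,
      ENNReal.mul_le_mul_iff_right (by simp) (by simp), ENNReal.ofReal_le_ofReal_iff (hnn a),
      sum_sq_div_eq_add hp hap ha ha'.1 hs] at hle
    have h0 : ∑ i, (a' i - a i) ^ 2 / w i = 0 :=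
      le_antisymm (by linarith) (hnn fun i => a' i - a i)
    ext i
    by_cases hi : w i = 0
    · rw [hs i hi, hsa i hi]
    · have := (Finset.sum_eq_zero_iff_of_nonneg
        fun i _ => div_nonneg (sq_nonneg (a' i - a i)) (hw i)).1 h0 i (Finset.mem_univ i)
      rw [div_eq_zero_iff, or_iff_left hi, sq_eq_zero_iff, sub_eq_zero] at this
      exact this

/-- The hypothesis `h` is the system of normal equations: the residual at `p` is orthogonal to `P`
in the weighted form, so Pythagoras applies. -/
lemma lsObjective_eq_add {u p q : V} (hq : q ∈ P) (hp : p ∈ P)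
    (h : ∀ q ∈ P, ∑ i, w i * L i p * L i q = ∑ i, w i * L i u * L i q) :
    lsObjective (fun i => L i) w u q
      = lsObjective (fun i => L i) w u p + (1 / 2) * ∑ i, w i * L i (q - p) ^ 2 := by
  have h' := h (p - q) (P.sub_mem hp hq)
  have : ∑ i, (L i u - L i q) ^ 2 * w i = ∑ i, (L i u - L i p) ^ 2 * w i
      + ∑ i, w i * L i (q - p) ^ 2
      + 2 * (∑ i, w i * L i u * L i (p - q) - ∑ i, w i * L i p * L i (p - q)) := by
    rw [← Finset.sum_sub_distrib, Finset.mul_sum, ← Finset.sum_add_distrib,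
      ← Finset.sum_add_distrib]
    refine Finset.sum_congr rfl fun i _ => ?_
    rw [map_sub, map_sub]
    ring
  rw [lsObjective, this, h', lsObjective]
  ring

lemma Unisolvent.existsUnique_isLSFit (hU : Unisolvent P L w) (hw : ∀ i, 0 ≤ w i) {u p : V}
    (hp : p ∈ P) (h : ∀ q ∈ P, ∑ i, w i * L i p * L i q = ∑ i, w i * L i u * L i q) :
    IsLSFit P (fun i => L i) w u p ∧ ∀ q, IsLSFit P (fun i => L i) w u q → q = p := by
  have hnn : ∀ v : V, 0 ≤ ∑ i, w i * L i v ^ 2 := fun v =>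
    Finset.sum_nonneg fun i _ => mul_nonneg (hw i) (sq_nonneg _)
  refine ⟨⟨hp, fun q hq => ?_⟩, fun q hq => ?_⟩
  · rw [lsObjective_eq_add hq hp h]
    linarith [hnn (q - p)]
  · have hle := hq.2 p hp
    rw [lsObjective_eq_add hq.1 hp h] at hle
    exact sub_eq_zero.1 (hU.eq_zero_of_sum_sq hw (P.sub_mem hq.1 hp)
      (le_antisymm (by linarith) (hnn (q - p))))

lemma algObjective_eq_lsObjective {Q : ℕ} (p : Fin Q → V) (u : V) (c : Fin Q → ℝ) :
    algObjective (fun i => L i) w p u c = lsObjective (fun i => L i) w u (∑ k, c k • p k) := by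
  classical
  simp only [algObjective, lsObjective, dotProduct, sampleMatrix, Matrix.mulVec_diagonal]
  congr 1
  refine Finset.sum_congr rfl fun i _ => ?_
  have : (Matrix.transpose (Matrix.of fun k i => L i (p k))).mulVec c i
      = L i (∑ k, c k • p k) := by
    simp only [Matrix.mulVec, dotProduct, Matrix.transpose_apply, Matrix.of_apply, map_sum,
      map_smul, smul_eq_mul]
    exact Finset.sum_congr rfl fun k _ => mul_comm _ _
  rw [Pi.sub_apply, this]
  ring

/-- Existence, uniqueness and equivalence of the two formulations of generalized moving least
squares. -/
theorem Unisolvent.exists_gmls [Module.Finite ℝ P] (hU : Unisolvent P L w) (hw : ∀ i, 0 ≤ w i)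
    {τ : V → ℝ} {a₀ : ι → ℝ} (h₀ : Reproduces P (fun i => L i) τ a₀) :
    ∃ a : ι → ℝ, IsQPSolution P (fun i => L i) τ w a ∧
      (∀ a', IsQPSolution P (fun i => L i) τ w a' → a' = a) ∧
      LocallySupported w a ∧
      (∀ a', Reproduces P (fun i => L i) τ a' → LocallySupported w a' →
        ∑ i, a i ^ 2 / w i ≤ ∑ i, a' i ^ 2 / w i) ∧
      ∀ u : V, (∃! p, IsLSFit P (fun i => L i) w u p) ∧
        ∀ (Q : ℕ) (p : Module.Basis (Fin Q) ℝ P), ∃ b : Fin Q → ℝ,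
          IsAlgSolution (fun i => L i) w (fun k => (p k : V)) u b ∧
          (∀ b', IsAlgSolution (fun i => L i) w (fun k => (p k : V)) u b' → b' = b) ∧
          IsLSFit P (fun i => L i) w u (∑ k, b k • (p k : V)) ∧
          ∑ k, b k * τ (p k) = ∑ i, a i * L i u := by
  -- `τ` is an arbitrary function on `V`; exactness of `a₀` identifies it on `P` with a linear
  -- functional, which `p₀` represents in the Gram form.
  obtain ⟨p₀, hp₀, hgram⟩ := hU.exists_gram hw (∑ i, a₀ i • (L i ∘ₗ P.subtype))
  have ha : Reproduces P (fun i => L i) τ fun i => w i * L i p₀ := by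
    intro q hq
    rw [hgram ⟨q, hq⟩, h₀ q hq]
    simp
  obtain ⟨hsol, huniq⟩ := isQPSolution_of_eq hw hp₀ (fun _ => rfl) ha
  refine ⟨_, hsol, huniq, fun i hi => by simp [hi], fun a' ha' hs => ?_, fun u => ?_⟩
  · rw [sum_sq_div_eq_add hp₀ (fun _ => rfl) ha ha' hs]
    exact le_add_of_nonneg_right (Finset.sum_nonneg fun i _ => div_nonneg (sq_nonneg _) (hw i))
  · obtain ⟨p, hp, hnormal⟩ := hU.exists_gram hw (∑ i, (w i * L i u) • (L i ∘ₗ P.subtype))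
    have hnormal' : ∀ q ∈ P, ∑ i, w i * L i p * L i q = ∑ i, w i * L i u * L i q := by
      intro q hq
      rw [hnormal ⟨q, hq⟩]
      simp
    obtain ⟨hfit, hfit_uniq⟩ := hU.existsUnique_isLSFit hw hp hnormal'
    refine ⟨⟨p, hfit, hfit_uniq⟩, fun Q e => ?_⟩
    have hcoe : ∀ c : Fin Q → ℝ, ∑ k, c k • (e k : V) = (e.equivFun.symm c : P) := by
      intro c
      rw [e.equivFun_symm_apply]
      simp
    set b := e.equivFun ⟨p, hp⟩ with hb
    have hbp : ∑ k, b k • (e k : V) = p := by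
      rw [hcoe, hb, LinearEquiv.symm_apply_apply]
    have hls : ∀ b', IsAlgSolution (fun i => L i) w (fun k => (e k : V)) u b' ↔
        IsLSFit P (fun i => L i) w u (∑ k, b' k • (e k : V)) := by
      intro b'
      simp only [IsAlgSolution, IsLSFit, algObjective_eq_lsObjective]
      refine ⟨fun h => ⟨by rw [hcoe]; exact Subtype.property _, fun q hq => ?_⟩,
        fun h c => h.2 _ (by rw [hcoe]; exact Subtype.property _)⟩
      have := h (e.equivFun ⟨q, hq⟩)
      rwa [hcoe (e.equivFun ⟨q, hq⟩), LinearEquiv.symm_apply_apply] at this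
    refine ⟨b, (hls b).2 (by rwa [hbp]), fun b' hb' => ?_, by rwa [hbp], ?_⟩
    · have h1 := hfit_uniq _ ((hls b').1 hb')
      rw [hcoe] at h1
      rw [hb, ← e.equivFun.symm_apply_eq]
      exact Subtype.ext h1
    -- Duality: the left side is the weighted product of `p₀` with the fit `p`. By symmetry and the
    -- normal equations `p` may be replaced by `u`.
    · calc ∑ k, b k * τ (e k) = ∑ k, b k * ∑ i, w i * L i p₀ * L i (e k) :=
            Finset.sum_congr rfl fun k _ => by rw [ha _ (e k).2]
        _ = ∑ i, w i * L i p₀ * L i p := by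
            conv_rhs => rw [← hbp]
            simp only [map_sum, map_smul, smul_eq_mul, Finset.mul_sum]
            rw [Finset.sum_comm]
            exact Finset.sum_congr rfl fun i _ => Finset.sum_congr rfl fun k _ => by ring
        _ = ∑ i, w i * L i p * L i p₀ := Finset.sum_congr rfl fun i _ => by ring
        _ = ∑ i, w i * L i u * L i p₀ := hnormal' p₀ hp₀
        _ = ∑ i, w i * L i p₀ * L i u := Finset.sum_congr rfl fun i _ => by ring

end LeastSquares

/-! ### Norming sets in cones -/

lemma cone_mono {d : ℕ} {x ξ : E d} {θ r r' : ℝ} (h : r ≤ r') : cone x ξ θ r ⊆ cone x ξ θ r' := by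
  rintro z ⟨y, t, hy, hyξ, ht0, ht, rfl⟩
  exact ⟨y, t, hy, hyξ, ht0, ht.trans h, rfl⟩

lemma norm_sub_le_of_mem_cone {d : ℕ} {x ξ z : E d} {θ r : ℝ} (hz : z ∈ cone x ξ θ r) :
    ‖x - z‖ ≤ r := by
  obtain ⟨y, t, hy, -, ht0, ht, rfl⟩ := hz
  rw [sub_add_cancel_left, norm_neg, norm_smul, hy, mul_one, Real.norm_eq_abs, abs_of_nonneg ht0]
  exact ht

/-- A cone contains a ball whose radius is proportional to that of the cone. -/
lemma closedBall_subset_cone {d : ℕ} {x ξ : E d} {θ s : ℝ} (hξ : ‖ξ‖ = 1)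
    (hθ₀ : 0 < θ) (hθ : θ < Real.pi / 2) (hs : 0 < s) :
    Metric.closedBall (x + s • ξ) (s * Real.sin θ) ⊆ cone x ξ θ (s * (1 + Real.sin θ)) := by
  intro z hz
  have hcos : 0 < Real.cos θ := Real.cos_pos_of_mem_Ioo ⟨by linarith, hθ⟩
  have hsin : 0 < Real.sin θ := Real.sin_pos_of_pos_of_lt_pi hθ₀ (by linarith)
  have hsq := Real.sin_sq_add_cos_sq θ
  have hsin1 : Real.sin θ < 1 := by nlinarith
  obtain ⟨w, hw⟩ : ∃ w, w = z - x := ⟨_, rfl⟩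
  have hws : ‖w - s • ξ‖ ≤ s * Real.sin θ := by
    rw [Metric.mem_closedBall, dist_eq_norm] at hz
    rwa [hw, sub_sub]
  have hnsξ : ‖s • ξ‖ = s := by rw [norm_smul, hξ, mul_one, Real.norm_eq_abs, abs_of_pos hs]
  have hwpos : 0 < ‖w‖ := by
    have h1 := norm_sub_norm_le (s • ξ) w
    rw [hnsξ, norm_sub_rev (s • ξ)] at h1
    nlinarith
  have hwle : ‖w‖ ≤ s * (1 + Real.sin θ) := by
    have h1 := norm_sub_norm_le w (s • ξ)
    rw [hnsξ] at h1
    linarith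
  have hin : ‖w‖ * Real.cos θ ≤ inner ℝ w ξ := by
    have h1 := norm_sub_sq_real w (s • ξ)
    rw [hnsξ, inner_smul_right] at h1
    have h2 : ‖w - s • ξ‖ ^ 2 ≤ (s * Real.sin θ) ^ 2 := by gcongr
    -- Expanding `h2` gives `‖w‖² + s² cos² θ ≤ 2 s ⟨w, ξ⟩`, and the left side is at least `2 s ‖w‖
    -- cos θ`.
    have h3 : 2 * s * (‖w‖ * Real.cos θ) ≤ 2 * s * inner ℝ w ξ := by
      nlinarith [sq_nonneg (‖w‖ - s * Real.cos θ)]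
    exact le_of_mul_le_mul_left h3 (by positivity)
  refine ⟨‖w‖⁻¹ • w, ‖w‖, ?_, ?_, hwpos.le, hwle, ?_⟩
  · rw [norm_smul, norm_inv, norm_norm, inv_mul_cancel₀ hwpos.ne']
  · rw [real_inner_smul_left, le_inv_mul_iff₀ hwpos]
    exact hin
  · rw [smul_smul, mul_inv_cancel₀ hwpos.ne', one_smul, hw, add_sub_cancel]

/-- Sufficiently dense points of a ball form a norming set for polynomials on the ball. -/
lemma exists_norming_point {d m : ℕ} (hm : 0 < m) {M : Finset (E d)} {z₀ : E d} {ρ h : ℝ}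
    (hh : 0 < h) (hρ : 16 * (m : ℝ) ^ 2 * h ≤ 3 * ρ)
    (hfill : ∀ z ∈ Metric.closedBall z₀ ρ, ∃ y ∈ M, dist z y ≤ h)
    {f : E d → ℝ} (hf : f ∈ polySpace d m) :
    ∃ B : ℝ, 0 ≤ B ∧ (∀ z ∈ Metric.closedBall z₀ ρ, |f z| ≤ B) ∧
      ∃ y ∈ M, y ∈ Metric.closedBall z₀ ρ ∧ B ≤ 2 * |f y| := by
  have hm1 : (1 : ℝ) ≤ (m : ℝ) ^ 2 := one_le_pow₀ (by exact_mod_cast hm)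
  have hρpos : 0 < ρ := by nlinarith
  obtain ⟨z, hz, hmax⟩ := (isCompact_closedBall z₀ ρ).exists_isMaxOn
    (Metric.nonempty_closedBall.2 hρpos.le) (continuous_of_mem_polySpace hf).abs.continuousOn
  refine ⟨|f z|, abs_nonneg _, fun y hy => hmax hy, ?_⟩
  -- The homothety with centre `z` and ratio `c` maps the ball into itself, onto a ball of radius
  -- `h`. The latter contains a sample point `y`, and `w` below is the preimage of `y`.
  set c := h / ρ with hc
  have hcpos : 0 < c := div_pos hh hρpos
  have hcle : c ≤ 3 / (16 * (m : ℝ) ^ 2) := by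
    rw [hc, div_le_div_iff₀ hρpos (by positivity)]
    linarith
  have hc1 : c ≤ 1 := by
    rw [hc, div_le_one hρpos]
    nlinarith
  have hconv := convex_closedBall z₀ ρ
  have hline : ∀ w ∈ Metric.closedBall z₀ ρ, ∀ t ∈ Set.Icc (0 : ℝ) 1,
      z + t • (w - z) ∈ Metric.closedBall z₀ ρ :=
    fun w hw t ht => hconv.add_smul_sub_mem hz hw ht
  obtain ⟨y, hyM, hy⟩ := hfill _
    (hline z₀ (Metric.mem_closedBall_self hρpos.le) c ⟨hcpos.le, hc1⟩)
  set w := z + c⁻¹ • (y - z) with hw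
  have hyw : z + c • (w - z) = y := by
    rw [hw, add_sub_cancel_left, smul_smul, mul_inv_cancel₀ hcpos.ne', one_smul, add_sub_cancel]
  have hwmem : w ∈ Metric.closedBall z₀ ρ := by
    have h1 : w - z₀ = c⁻¹ • (y - (z + c • (z₀ - z))) := by
      rw [← hyw, add_sub_add_left_eq_sub, ← smul_sub, smul_smul, inv_mul_cancel₀ hcpos.ne',
        one_smul, sub_sub_sub_cancel_right]
    rw [Metric.mem_closedBall, dist_eq_norm, h1, norm_smul, norm_inv, Real.norm_eq_abs,
      abs_of_pos hcpos, ← dist_eq_norm, dist_comm, inv_mul_le_iff₀ hcpos, hc,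
      div_mul_cancel₀ _ hρpos.ne']
    exact hy
  refine ⟨y, hyM, hyw ▸ hline w hwmem c ⟨hcpos.le, hc1⟩, ?_⟩
  obtain ⟨q, hq, hqf⟩ := exists_polynomial_of_mem_polySpace hf z (w - z)
  have := half_le_abs_eval_of_maximal_at_zero hm hq
    (fun t ht => by rw [hqf]; exact hmax (hline w hwmem t ht)) (by rw [hqf]; simp)
    hcpos.le hcle
  rw [hqf, hyw] at this
  linarith

/-- `C(θ)` is tuned so that the ball fits into the cone of radius `C(θ) h / 2` and still satisfies
`16 m² h ≤ 3 ρ`. The exact distance `ρ / sin θ` places `x`, after rescaling the ball to the unit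
ball, at a radius that depends only on `θ`. -/
lemma exists_norming_ball {d m : ℕ} (hm : 0 < m) {θ : ℝ} (hθ₀ : 0 < θ) (hθ : θ < Real.pi / 2)
    {Ω : Set (E d)} {r : ℝ} (hΩ : InteriorCone Ω r θ) {x : E d} (hx : x ∈ Ω) {h : ℝ} (hh : 0 < h)
    (hr : coneConst m θ * h ≤ r) {M : Finset (E d)} (hfill : ∀ z ∈ Ω, ∃ y ∈ M, dist z y ≤ h) :
    ∃ (z₀ : E d) (ρ : ℝ), h ≤ ρ ∧ ‖x - z₀‖ = ρ / Real.sin θ ∧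
      ∀ f ∈ polySpace d m, ∃ B : ℝ, 0 ≤ B ∧ (∀ z ∈ Metric.closedBall z₀ ρ, |f z| ≤ B) ∧
        ∃ y ∈ M, ‖x - y‖ ≤ coneConst m θ * h / 2 ∧ B ≤ 2 * |f y| := by
  have hsin : 0 < Real.sin θ := Real.sin_pos_of_pos_of_lt_pi hθ₀ (by linarith)
  have hsin1 := Real.sin_le_one θ
  have hm1 : (1 : ℝ) ≤ (m : ℝ) ^ 2 := one_le_pow₀ (by exact_mod_cast hm)
  obtain ⟨ξ, hξ, hcone⟩ := hΩ x hx
  set s : ℝ := 8 * (1 + Real.sin θ) * (m : ℝ) ^ 2 * h / (3 * Real.sin θ ^ 2) with hs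
  have hspos : 0 < s := by positivity
  have hsR : s * (1 + Real.sin θ) = coneConst m θ * h / 2 := by
    rw [hs, coneConst]
    field_simp
    ring
  have hCh : 0 < coneConst m θ * h := by
    have : 0 < s * (1 + Real.sin θ) := by positivity
    linarith
  have hρ : 16 * (m : ℝ) ^ 2 * h ≤ 3 * (s * Real.sin θ) := by
    have h1 : 3 * (s * Real.sin θ) * Real.sin θ = 8 * (1 + Real.sin θ) * (m : ℝ) ^ 2 * h := by
      rw [hs]
      field_simp
    refine le_of_mul_le_mul_right ?_ hsin
    rw [h1]
    have : 0 ≤ 8 * (m : ℝ) ^ 2 * h := by positivity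
    nlinarith
  have hball := closedBall_subset_cone (x := x) hξ hθ₀ hθ hspos
  have hballΩ : Metric.closedBall (x + s • ξ) (s * Real.sin θ) ⊆ Ω :=
    hball.trans ((cone_mono (by linarith)).trans hcone)
  refine ⟨x + s • ξ, s * Real.sin θ, by nlinarith, ?_, fun f hf => ?_⟩
  · rw [sub_add_cancel_left, norm_neg, norm_smul, hξ, mul_one, Real.norm_eq_abs, abs_of_pos hspos,
      mul_div_cancel_right₀ _ hsin.ne']
  · obtain ⟨B, hB, hfB, y, hyM, hy, hBy⟩ :=
      exists_norming_point hm hh hρ (fun z hz => hfill z (hballΩ hz)) hf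
    exact ⟨B, hB, hfB, y, hyM, hsR ▸ norm_sub_le_of_mem_cone (hball hy), hBy⟩

/-- Local polynomial reproduction of derivatives at points of a region with the interior cone
condition, together with unisolvence of the local point sets. -/
theorem exists_local_reproduction (d m : ℕ) (hm : 0 < m) (θ : ℝ) (α : Fin d → ℕ) :
    ∃ C₀ : ℝ, 0 < C₀ ∧ ∀ (Ω : Set (E d)) (r : ℝ) (x : E d) (h : ℝ) (M : Finset (E d)),
      0 < θ → θ < Real.pi / 2 → InteriorCone Ω r θ → x ∈ Ω → 0 < h → coneConst m θ * h ≤ r →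
      (∀ z ∈ Ω, ∃ y ∈ M, dist z y ≤ h) →
      (∀ f ∈ polySpace d m, (∀ y ∈ M, ‖x - y‖ ≤ coneConst m θ * h / 2 → f y = 0) → f = 0) ∧
      ∃ a : M → ℝ, Reproduces (polySpace d m) (pointSamples M) (derivTarget x α) a ∧
        (∀ y : M, coneConst m θ * h / 2 < ‖x - (y : E d)‖ → a y = 0) ∧
        ∑ y, |a y| ≤ C₀ / h ^ order α := by
  classical
  obtain ⟨K, hK, hKb⟩ := exists_multiD_bound d m α (1 / Real.sin θ)
  refine ⟨K * 2, by positivity, fun Ω r x h M hθ₀ hθ hΩ hx hh hr hfill => ?_⟩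
  obtain ⟨z₀, ρ, hρ, hxz, hnorm⟩ := exists_norming_ball hm hθ₀ hθ hΩ hx hh hr hfill
  have hρpos : 0 < ρ := hh.trans_le hρ
  refine ⟨fun f hf h0 => ?_, ?_⟩
  · obtain ⟨B, -, hfB, y, hyM, hy, hBy⟩ := hnorm f hf
    rw [h0 y hyM hy, abs_zero, mul_zero] at hBy
    exact eq_zero_of_mem_polySpace_of_ball hf hρpos fun z hz =>
      abs_nonpos_iff.1 ((hfB z hz).trans hBy)
  · let τ : polySpace d m →ₗ[ℝ] ℝ :=
      { toFun := fun f => multiD α f.1 x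
        map_add' := fun f g => congrFun (multiD_add α f.2 g.2) x
        map_smul' := fun c f => congrFun (multiD_smul α c f.2) x }
    -- Samples far from `x` are replaced by zero, so that their coefficients can be set to zero
    -- afterwards.
    let L : M → polySpace d m →ₗ[ℝ] ℝ := fun y =>
      if ‖x - (y : E d)‖ ≤ coneConst m θ * h / 2 then
        (LinearMap.proj (y : E d) : (E d → ℝ) →ₗ[ℝ] ℝ) ∘ₗ (polySpace d m).subtype else 0
    have hτ : ∀ f, |τ f| ≤ K * 2 / h ^ order α * ‖fun y => L y f‖ := by
      rintro ⟨f, hf⟩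
      obtain ⟨B, hB, hfB, y, hyM, hy, hBy⟩ := hnorm f hf
      have h1 := hKb _ (comp_affine_mem_polySpace hf z₀ ρ) B hB (fun v hv => hfB _ (by
        rw [mem_closedBall_zero_iff] at hv
        rw [Metric.mem_closedBall, dist_eq_norm, add_sub_cancel_left, norm_smul, Real.norm_eq_abs,
          abs_of_pos hρpos]
        exact mul_le_of_le_one_right hρpos.le hv)) (ρ⁻¹ • (x - z₀)) (by
        rw [mem_closedBall_zero_iff, norm_smul, norm_inv, Real.norm_eq_abs, abs_of_pos hρpos, hxz]
        exact le_of_eq (by field_simp))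
      rw [multiD_comp_affine] at h1
      dsimp only at h1
      rw [smul_smul, mul_inv_cancel₀ hρpos.ne', one_smul, add_sub_cancel,
        abs_mul, abs_of_pos (pow_pos hρpos _)] at h1
      have h2 : |f y| ≤ ‖fun y => L y ⟨f, hf⟩‖ := by
        refine le_trans (le_of_eq ?_) (norm_le_pi_norm (fun y => L y ⟨f, hf⟩) ⟨y, hyM⟩)
        simp [L, hy]
      -- `h ≤ ρ` trades the radius of the ball for the fill distance without a new constant.
      have h3 : h ^ order α * |multiD α f x| ≤ K * B :=
        (mul_le_mul_of_nonneg_right (pow_le_pow_left₀ hh.le hρ _) (abs_nonneg _)).trans h1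
      rw [div_mul_eq_mul_div, le_div_iff₀ (pow_pos hh _), mul_comm, mul_assoc]
      exact h3.trans (mul_le_mul_of_nonneg_left (hBy.trans (by linarith)) hK.le)
    obtain ⟨a, ha, hab⟩ := exists_coeff_of_norming L τ (by positivity) hτ
    refine ⟨fun y => if ‖x - (y : E d)‖ ≤ coneConst m θ * h / 2 then a y else 0, fun f hf => ?_,
      fun y hy => if_neg hy.not_ge, (Finset.sum_le_sum fun y _ => ?_).trans hab⟩
    · refine (ha ⟨f, hf⟩).trans (Finset.sum_congr rfl fun y _ => ?_)
      by_cases hy : ‖x - (y : E d)‖ ≤ coneConst m θ * h / 2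
      · simp [L, hy, pointSamples]
      · simp [L, hy]
    · dsimp only
      split_ifs <;> simp

/-! ### Dependence on the weights -/

/-- The number of separated points in a ball is bounded. -/
lemma exists_card_le_of_separated (d : ℕ) {η : ℝ} (hη : 0 < η) (R : ℝ) :
    ∃ N : ℕ, ∀ (M : Finset (E d)) (x : E d) (h : ℝ), 0 < h →
      (∀ y ∈ M, ∀ y' ∈ M, y ≠ y' → 2 * η * h ≤ dist y y') → (∀ y ∈ M, ‖x - y‖ ≤ R * h) →
      M.card ≤ N := by
  classical
  obtain ⟨t, ht, hcover⟩ := Metric.totallyBounded_iff.1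
    (isCompact_closedBall (0 : E d) R).totallyBounded η hη
  refine ⟨ht.toFinset.card, fun M x h hh hsep hR => ?_⟩
  -- After scaling by `h⁻¹`, distinct points are at least `2 η` apart, so each open `η`-ball of the
  -- cover contains at most one of them.
  have hnear : ∀ y ∈ M, ∃ z ∈ t, dist (h⁻¹ • (x - y)) z < η := by
    intro y hy
    have := hcover (a := h⁻¹ • (x - y)) (by
      rw [mem_closedBall_zero_iff, norm_smul, norm_inv, Real.norm_eq_abs, abs_of_pos hh,
        inv_mul_le_iff₀ hh, mul_comm]
      exact hR y hy)
    simpa using this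
  choose! g hgt hg using hnear
  refine Finset.card_le_card_of_injOn g (fun y hy => by simpa using hgt y hy) fun y hy y' hy' he => ?_
  by_contra hne
  have h1 := hsep y hy y' hy' hne
  have h2 : dist (h⁻¹ • (x - y)) (h⁻¹ • (x - y')) < η + η :=
    (dist_triangle_right _ _ (g y)).trans_lt (add_lt_add (hg y hy) (he ▸ hg y' hy'))
  rw [dist_smul₀, dist_sub_left, norm_inv, Real.norm_eq_abs, abs_of_pos hh,
    inv_mul_lt_iff₀ hh] at h2
  linarith

/-- Cauchy-Schwarz for `|a i| = (|a i| / √(w i)) * √(w i)`. -/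
lemma sum_abs_sq_le_of_locallySupported {ι : Type*} [Fintype ι] {w a : ι → ℝ}
    (hw : ∀ i, 0 ≤ w i) (ha : LocallySupported w a) :
    (∑ i, |a i|) ^ 2 ≤ (∑ i, a i ^ 2 / w i) * ∑ i, w i := by
  refine Finset.sum_sq_le_sum_mul_sum_of_sq_le_mul _ (fun i _ => div_nonneg (sq_nonneg _) (hw i))
    (fun i _ => hw i) fun i _ => ?_
  by_cases hi : w i = 0
  · simp [hi, ha i hi]
  · rw [sq_abs, div_mul_cancel₀ _ hi]

lemma sum_sq_div_le_of_le {ι : Type*} [Fintype ι] {w b : ι → ℝ} {μ : ℝ} (hμ : 0 < μ)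
    (hb : ∀ i, b i ≠ 0 → μ ≤ w i) : ∑ i, b i ^ 2 / w i ≤ (∑ i, |b i|) ^ 2 / μ := by
  calc ∑ i, b i ^ 2 / w i ≤ ∑ i, |b i| * (∑ j, |b j|) / μ := by
        refine Finset.sum_le_sum fun i _ => ?_
        by_cases hi : b i = 0
        · simp [hi]
        · rw [← sq_abs, sq]
          have h1 : |b i| ≤ ∑ j, |b j| :=
            Finset.single_le_sum (f := fun j => |b j|) (fun j _ => abs_nonneg _)
              (Finset.mem_univ i)
          have h2 := hb i hi
          gcongr
    _ = (∑ i, |b i|) ^ 2 / μ := by rw [← Finset.sum_div, ← Finset.sum_mul, sq]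

/-- Coefficients with a smaller weighted norm than a vector supported near the center have a
comparable `ℓ¹`-norm, uniformly in the scale of the weight. -/
lemma exists_weight_factor (d : ℕ) (κ c : ℝ) (φ : ℝ → ℝ) :
    ∃ A : ℝ, 0 < A ∧ ∀ (x : E d) (M : Finset (E d)) (h : ℝ) (Φ : ℝ → ℝ), 0 < h → 0 < c → 0 < κ →
      (∀ y ∈ M, ∀ y' ∈ M, y ≠ y' → 2 * c⁻¹ * h ≤ dist y y') →
      WeightCondition Φ (2 * κ * h) → ContinuousOn φ (Set.Ici 0) →
      (∀ t, 0 ≤ t → Φ t = φ (t / (2 * κ * h))) →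
      ∀ a b : M → ℝ, LocallySupported (pointWeights Φ x M) a →
        (∀ y : M, κ * h / 2 < ‖x - (y : E d)‖ → b y = 0) →
        ∑ y, a y ^ 2 / pointWeights Φ x M y ≤ ∑ y, b y ^ 2 / pointWeights Φ x M y →
        ∑ y, |a y| ≤ A * ∑ y, |b y| := by
  classical
  -- `A` is chosen before the data. If `c` and `φ` lack these properties, no admissible data exist
  -- and any positive `A` serves. The bound `1/4` is the radius `κ h / 2` of the support of `b`
  -- relative to `2 κ h`.
  by_cases hφ : 0 < c ∧ ContinuousOn φ (Set.Ici 0) ∧ ∀ t ∈ Set.Icc (0 : ℝ) (1 / 4), 0 < φ t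
  swap
  · refine ⟨1, one_pos, fun x M h Φ hh hc hκ _ hΦ hcont hΦφ => absurd ⟨hc, hcont, ?_⟩ hφ⟩
    rintro t ⟨ht0, ht⟩
    have hδ : 0 < 2 * κ * h := by positivity
    have h1 := hΦφ (t * (2 * κ * h)) (by positivity)
    rw [mul_div_cancel_right₀ _ hδ.ne'] at h1
    rw [← h1]
    exact hΦ.pos _ (by positivity) (by nlinarith)
  obtain ⟨hc, hcont, hpos⟩ := hφ
  obtain ⟨N, hN⟩ := exists_card_le_of_separated d (inv_pos.2 hc) (2 * κ)
  obtain ⟨W, hW⟩ := isCompact_Icc.exists_bound_of_continuousOn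
    (hcont.mono (Set.Icc_subset_Ici_self : Set.Icc (0 : ℝ) 1 ⊆ Set.Ici 0))
  have hW0 : 0 ≤ W := (norm_nonneg _).trans (hW 0 ⟨le_rfl, zero_le_one⟩)
  obtain ⟨t₀, ht₀, hmin⟩ := isCompact_Icc.exists_isMinOn ⟨0, by constructor <;> norm_num⟩
    (hcont.mono (Set.Icc_subset_Ici_self : Set.Icc (0 : ℝ) (1 / 4) ⊆ Set.Ici 0))
  have hμ := hpos t₀ ht₀
  -- The summand `1` gives `N * W / φ t₀ ≤ A ≤ A ^ 2`, which avoids a square root.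
  set A := N * W / φ t₀ + 1 with hA
  have hA1 : 1 ≤ A := by
    have : 0 ≤ N * W / φ t₀ := by positivity
    linarith
  refine ⟨A, by linarith, fun x M h Φ hh _ hκ hsep hΦ _ hΦφ a b ha hb hab => ?_⟩
  have hδ : 0 < 2 * κ * h := by positivity
  have hw : ∀ y, 0 ≤ pointWeights Φ x M y := fun y => hΦ.nonneg _ (norm_nonneg _)
  have hsumw : ∑ y, pointWeights Φ x M y ≤ N * W := by
    have h1 : ∑ y, pointWeights Φ x M y = ∑ y ∈ M with ‖x - y‖ ≤ 2 * κ * h, Φ ‖x - y‖ := by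
      rw [Finset.sum_filter, ← Finset.sum_coe_sort M]
      refine Finset.sum_congr rfl fun y _ => ?_
      split_ifs with hy
      · rfl
      · exact hΦ.support _ (not_le.1 hy)
    rw [h1]
    refine (Finset.sum_le_card_nsmul _ _ W fun y hy => ?_).trans ?_
    · rw [hΦφ _ (norm_nonneg _)]
      exact (le_abs_self _).trans (hW _ ⟨by positivity,
        (div_le_one hδ).2 (Finset.mem_filter.1 hy).2⟩)
    · rw [nsmul_eq_mul]
      refine mul_le_mul_of_nonneg_right (Nat.cast_le.2 (hN _ x h hh ?_ ?_)) hW0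
      · exact fun y hy y' hy' => hsep y (Finset.mem_filter.1 hy).1 y' (Finset.mem_filter.1 hy').1
      · exact fun y hy => (Finset.mem_filter.1 hy).2
  have hbw : ∀ y, b y ≠ 0 → φ t₀ ≤ pointWeights Φ x M y := by
    intro y hy
    have h1 : ‖x - (y : E d)‖ ≤ κ * h / 2 := not_lt.1 fun h1 => hy (hb y h1)
    rw [pointWeights, hΦφ _ (norm_nonneg _)]
    refine hmin ⟨by positivity, ?_⟩
    rw [div_le_iff₀ hδ]
    linarith
  have hsq : (∑ y, |a y|) ^ 2 ≤ (A * ∑ y, |b y|) ^ 2 := by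
    calc (∑ y, |a y|) ^ 2
        ≤ (∑ y, a y ^ 2 / pointWeights Φ x M y) * ∑ y, pointWeights Φ x M y :=
          sum_abs_sq_le_of_locallySupported hw ha
      _ ≤ ((∑ y, |b y|) ^ 2 / φ t₀) * (N * W) :=
          mul_le_mul (hab.trans (sum_sq_div_le_of_le hμ hbw)) hsumw
            (Finset.sum_nonneg fun y _ => hw y) (by positivity)
      _ = N * W / φ t₀ * (∑ y, |b y|) ^ 2 := by ring
      _ ≤ A ^ 2 * (∑ y, |b y|) ^ 2 := by
          refine mul_le_mul_of_nonneg_right ?_ (sq_nonneg _)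
          nlinarith
      _ = (A * ∑ y, |b y|) ^ 2 := by ring
  exact le_of_sq_le_sq hsq (mul_nonneg (by linarith) (Finset.sum_nonneg fun y _ => abs_nonneg _))

/-! ### Fill and separation distance -/

lemma exists_dist_le_fillDistance {d : ℕ} {X : Finset (E d)} {Ω : Set (E d)} (hX : X.Nonempty)
    (hΩ : IsCompact Ω) : ∀ z ∈ Ω, ∃ y ∈ X, dist z y ≤ fillDistance (X : Set (E d)) Ω := by
  intro z hz
  obtain ⟨y, hy, hzy⟩ := X.finite_toSet.isCompact.exists_infDist_eq_dist hX z
  refine ⟨y, hy, hzy ▸ le_csSup ?_ (Set.mem_image_of_mem _ hz)⟩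
  exact (hΩ.image (Metric.continuous_infDist_pt _)).bddAbove

/-- The cone at `x` contains a segment of its axis. This is what makes the fill distance of a finite
set positive. -/
lemma RegionCondition.infinite {d : ℕ} {Ω : Set (E d)} {r θ : ℝ} (hΩ : RegionCondition Ω r θ)
    {x : E d} (hx : x ∈ Ω) : Ω.Infinite := by
  obtain ⟨ξ, hξ, hcone⟩ := hΩ.interiorCone x hx
  refine Set.infinite_of_injOn_mapsTo (f := fun t : ℝ => x + t • ξ) ?_ ?_
    (Set.Icc_infinite hΩ.r_pos)
  · intro t _ t' _ h
    have hξ0 : ξ ≠ 0 := by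
      rintro rfl
      simp at hξ
    exact smul_left_injective ℝ hξ0 (add_left_cancel h)
  · rintro t ⟨ht0, ht⟩
    refine hcone ⟨ξ, t, hξ, ?_, ht0, ht, rfl⟩
    rw [real_inner_self_eq_norm_sq, hξ, one_pow]
    exact Real.cos_le_one θ

lemma fillDistance_pos {d : ℕ} {X : Finset (E d)} {Ω : Set (E d)} (hX : X.Nonempty)
    (hΩ : IsCompact Ω) (hinf : Ω.Infinite) : 0 < fillDistance (X : Set (E d)) Ω := by
  by_contra! hle
  refine hinf (X.finite_toSet.subset fun z hz => ?_)
  obtain ⟨y, hy, hzy⟩ := exists_dist_le_fillDistance hX hΩ z hz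
  rwa [dist_le_zero.1 (hzy.trans hle)]

lemma coneConst_pos {m : ℕ} (hm : 0 < m) {θ : ℝ} (hθ₀ : 0 < θ) (hθ : θ < Real.pi / 2) :
    0 < coneConst m θ := by
  have hsin : 0 < Real.sin θ := Real.sin_pos_of_pos_of_lt_pi hθ₀ (by linarith)
  have : (0 : ℝ) < m := by exact_mod_cast hm
  unfold coneConst
  positivity

lemma QuasiUniform.const_pos {d : ℕ} {X Ω : Set (E d)} {c : ℝ} (h : QuasiUniform X Ω c)
    (hpos : 0 < fillDistance X Ω) : 0 < c := by
  have h1 : 0 < c * separationDistance X := hpos.trans_le h.2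
  exact pos_of_mul_pos_left h1 (div_nonneg Set.infsep_nonneg zero_le_two)

lemma QuasiUniform.le_dist {d : ℕ} {X Ω : Set (E d)} {c : ℝ} (h : QuasiUniform X Ω c)
    (hpos : 0 < fillDistance X Ω) {y y' : E d} (hy : y ∈ X) (hy' : y' ∈ X) (hne : y ≠ y') :
    2 * c⁻¹ * fillDistance X Ω ≤ dist y y' := by
  have h1 := Set.infsep_le_dist_of_mem hy hy' hne
  have h2 : c⁻¹ * fillDistance X Ω ≤ Set.infsep X / 2 :=
    (inv_mul_le_iff₀ (h.const_pos hpos)).2 h.2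
  linarith

end GMLS

/-! ### The theorem: local reproduction, duality and weight comparison combined -/

theorem lemma3p2 (d m : ℕ) (hm : 0 < m) (θ : ℝ) (α : Fin d → ℕ) :
    -- `C₀` depends only on `d, m, θ, α`; `C₁` also on the quasi-uniformity constant
    -- and on the rescaled weight profile
    ∃ (C₀ : ℝ) (C₁ : ℝ → (ℝ → ℝ) → ℝ), 0 < C₀ ∧ (∀ c φ, 0 < C₁ c φ) ∧
    ∀ (Ωh : Finset (GMLS.E d)) (x : GMLS.E d) (ε : ℝ) (M : Finset (GMLS.E d))
      (Ω : Set (GMLS.E d)) (r c : ℝ) (Φ : ℝ → ℝ),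
      x ∈ Ωh → 0 < ε →
      -- `M` is the set of midpoints, without or with the degenerate edge from `x` to `x`
      ((M : Set (GMLS.E d)) = GMLS.edgeMidpoints Ωh x ε ∨
        (M : Set (GMLS.E d)) = insert x (GMLS.edgeMidpoints Ωh x ε)) →
      x ∈ Ω →
      GMLS.RegionCondition Ω r θ →
      GMLS.PointCondition M Ω m r θ c →
      GMLS.WeightCondition Φ
        (2 * GMLS.coneConst m θ * GMLS.fillDistance (M : Set (GMLS.E d)) Ω) →
      -- coefficients with a bound that does not depend on the weight
      (∃ a : M → ℝ,
        GMLS.Reproduces (GMLS.polySpaceVanishing d m x) (GMLS.pointSamples M)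
          (GMLS.derivTarget x α) a ∧
        GMLS.LocallySupported (GMLS.pointWeights Φ x M) a ∧
        ∑ y, |a y| ≤ C₀ / GMLS.fillDistance (M : Set (GMLS.E d)) Ω ^ GMLS.order α ∧
        ∀ y : M, 2 * GMLS.coneConst m θ * GMLS.fillDistance (M : Set (GMLS.E d)) Ω
          < ‖x - (y : GMLS.E d)‖ → a y = 0) ∧
      -- the GMLS coefficients and the equivalent least-squares problem
      (∃ a : M → ℝ,
        GMLS.IsQPSolution (GMLS.polySpaceVanishing d m x) (GMLS.pointSamples M)
          (GMLS.derivTarget x α) (GMLS.pointWeights Φ x M) a ∧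
        (∀ a' : M → ℝ,
          GMLS.IsQPSolution (GMLS.polySpaceVanishing d m x) (GMLS.pointSamples M)
            (GMLS.derivTarget x α) (GMLS.pointWeights Φ x M) a' → a' = a) ∧
        GMLS.Reproduces (GMLS.polySpaceVanishing d m x) (GMLS.pointSamples M)
          (GMLS.derivTarget x α) a ∧
        GMLS.LocallySupported (GMLS.pointWeights Φ x M) a ∧
        (∀ φ : ℝ → ℝ, ContinuousOn φ (Set.Ici 0) →
          (∀ t, 0 ≤ t → Φ t =
            φ (t / (2 * GMLS.coneConst m θ * GMLS.fillDistance (M : Set (GMLS.E d)) Ω))) →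
          ∑ y, |a y| ≤ C₁ c φ / GMLS.fillDistance (M : Set (GMLS.E d)) Ω ^ GMLS.order α) ∧
        (∀ y : M, 2 * GMLS.coneConst m θ * GMLS.fillDistance (M : Set (GMLS.E d)) Ω
          < ‖x - (y : GMLS.E d)‖ → a y = 0) ∧
        ∀ u : GMLS.E d → ℝ,
          (∃! pstar : GMLS.E d → ℝ,
            GMLS.IsLSFit (GMLS.polySpaceVanishing d m x) (GMLS.pointSamples M)
              (GMLS.pointWeights Φ x M) u pstar) ∧
          ∀ (Q : ℕ) (p : Module.Basis (Fin Q) ℝ (GMLS.polySpaceVanishing d m x)),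
            ∃ b : Fin Q → ℝ,
              GMLS.IsAlgSolution (GMLS.pointSamples M) (GMLS.pointWeights Φ x M)
                (fun k => (p k : GMLS.E d → ℝ)) u b ∧
              (∀ b' : Fin Q → ℝ,
                GMLS.IsAlgSolution (GMLS.pointSamples M) (GMLS.pointWeights Φ x M)
                  (fun k => (p k : GMLS.E d → ℝ)) u b' → b' = b) ∧
              GMLS.IsLSFit (GMLS.polySpaceVanishing d m x) (GMLS.pointSamples M)
                (GMLS.pointWeights Φ x M) u (∑ k, b k • (p k : GMLS.E d → ℝ)) ∧
              GMLS.gmlsDerivative x α (fun k => (p k : GMLS.E d → ℝ)) b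
                = ∑ y : M, a y * u y) := by
  obtain ⟨C₀, hC₀, hloc⟩ := GMLS.exists_local_reproduction d m hm θ α
  choose A hA hAb using GMLS.exists_weight_factor d (GMLS.coneConst m θ)
  refine ⟨C₀, fun c φ => A c φ * C₀, hC₀, fun c φ => mul_pos (hA c φ) hC₀, ?_⟩
  intro _ x _ M Ω r c Φ _ _ _ hx hΩ hM hΦ
  have hh := GMLS.fillDistance_pos hM.nonempty hΩ.isCompact (hΩ.infinite hx)
  have hfill := GMLS.exists_dist_le_fillDistance hM.nonempty hΩ.isCompact
  have hκ := GMLS.coneConst_pos hm hΩ.θ_pos hΩ.θ_lt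
  have hc := hM.quasiUniform.const_pos hh
  have hsep := fun y (hy : y ∈ M) y' (hy' : y' ∈ M) hne =>
    hM.quasiUniform.le_dist hh (Finset.mem_coe.2 hy) (Finset.mem_coe.2 hy') hne
  have hr := (le_div_iff₀' hκ).1 hM.fill_le
  generalize GMLS.fillDistance (M : Set (GMLS.E d)) Ω = h at *
  have hκh : 0 < GMLS.coneConst m θ * h := mul_pos hκ hh
  obtain ⟨hU, a₀, ha₀, ha₀s, ha₀b⟩ :=
    hloc Ω r x h M hΩ.θ_pos hΩ.θ_lt hΩ.interiorCone hx hh hr hfill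
  have hP : GMLS.polySpaceVanishing d m x ≤ GMLS.polySpace d m := inf_le_left
  have hw : ∀ y, 0 ≤ GMLS.pointWeights Φ x M y := fun y => hΦ.nonneg _ (norm_nonneg _)
  have hfar : ∀ b : M → ℝ, GMLS.LocallySupported (GMLS.pointWeights Φ x M) b →
      ∀ y : M, 2 * GMLS.coneConst m θ * h < ‖x - (y : GMLS.E d)‖ → b y = 0 :=
    fun b hb y hy => hb y (hΦ.support _ hy)
  have ha₀P : GMLS.Reproduces (GMLS.polySpaceVanishing d m x) (GMLS.pointSamples M)
      (GMLS.derivTarget x α) a₀ := fun f hf => ha₀ f (hP hf)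
  -- A point within `C(θ) h / 2 = δ / 4` of `x` lies in the open ball of radius `δ / 2`, where the
  -- weight is positive.
  have ha₀l : GMLS.LocallySupported (GMLS.pointWeights Φ x M) a₀ := by
    intro y hy
    refine ha₀s y ?_
    by_contra! hle
    exact (hΦ.pos _ (norm_nonneg _) (by linarith)).ne' hy
  let L : M → (GMLS.E d → ℝ) →ₗ[ℝ] ℝ := fun y => LinearMap.proj (y : GMLS.E d)
  have hUL : GMLS.Unisolvent (GMLS.polySpaceVanishing d m x) L (GMLS.pointWeights Φ x M) :=
    fun f hf hf0 => hU f (hP hf) fun y hy hxy =>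
      hf0 ⟨y, hy⟩ (hΦ.pos _ (norm_nonneg _) (by linarith))
  obtain ⟨a, haQ, hauniq, hal, hamin, hfit⟩ := hUL.exists_gmls (τ := GMLS.derivTarget x α) hw ha₀P
  refine ⟨⟨a₀, ha₀P, ha₀l, ha₀b, hfar a₀ ha₀l⟩,
    a, haQ, hauniq, haQ.1, hal, fun φ hφ hΦφ => ?_, hfar a hal, hfit⟩
  -- The weight-independent vector `a₀` is an admissible competitor for the optimal `a`, so its `ℓ¹`
  -- bound passes to `a` with the factor `A c φ`.
  refine (hAb c φ x M h Φ hh hc hκ hsep hΦ hφ hΦφ a a₀ hal ha₀s (hamin a₀ ha₀P ha₀l)).trans ?_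
  rw [mul_div_assoc]
  exact mul_le_mul_of_nonneg_left ha₀b (hA c φ).le
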